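/- Let $\mathbb H=\{z\in\mathbb C:\Im z>0\}$. For a bounded Borel measurable function $\sigma:[0,1]^2\to\mathbb R$ (in particular for a non-negative symmetric one) let $(Sf)(x)=\int_0^1\sigma^2(x,y)f(y)\,dy$, and consider the canonical equation $$-\frac1{m(z)(x)}=z+(S\,m(z))(x)\qquad (z\in\mathbb H,\ x\in[0,1]),$$ whose unknown $m$ assigns to every $z\in\mathbb H$ a bounded measurable function $m(z):[0,1]\to\mathbb H$. Let $\mu_\sigma:=\int_0^1 p_x\,dx$, where $(p_x)_{x\in[0,1]}$ is a measurable family of probability measures on $\mathbb R$ such that $m(z)(x)=\int_{\mathbb R}\frac{dp_x(t)}{t-z}$ for all $z\in\mathbb H$ and $x\in[0,1]$, with $m$ a solution of the canonical equation. Theorem. Let $\sigma:[0,1]^2\to\mathbb R$ be a bounded Borel measurable function. Then $\mu_\sigma$ is well defined, i.e. there is exactly one probability measure on $\mathbb R$ that arises in this way from $\sigma$. Moreover, for every open neighbourhood $\mathcal V$ of $\mu_\sigma$ in the space of probability measures on $\mathbb R$ with the weak topology there is $\eta>0$ such that, for every bounded Borel measurable $\tilde\sigma:[0,1]^2\to\mathbb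 R$ with $\sup_{x,y\in[0,1]}|\sigma^2(x,y)-\tilde\sigma^2(x,y)|\le\eta$, one has $\mu_{\tilde\sigma}\in\mathcal V$. -/

import Mathlib

open MeasureTheory ProbabilityTheory
open scoped UpperHalfPlane

noncomputable section

/-- `σ : [0,1]² → ℝ` is bounded and (jointly, Borel) measurable. -/
structure IsBoundedMeasurable (σ : unitInterval → unitInterval → ℝ) : Prop where
  measurable : Measurable (Function.uncurry σ)
  bounded : ∃ C : ℝ, ∀ x y, |σ x y| ≤ C

/-- The kernel operator `S f (x) = ∫₀¹ σ(x,y)² f(y) dy`. -/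
def kernelOp (σ : unitInterval → unitInterval → ℝ) (f : unitInterval → ℂ)
    (x : unitInterval) : ℂ :=
  ∫ y : unitInterval, ((σ x y ^ 2 : ℝ) : ℂ) * f y

/-- `m` solves the canonical (quadratic vector) equation `-1 / m(z) = z + S m(z)`:
for every `z` in the upper half-plane, `m(z)` is a bounded measurable function from `[0,1]`
to the upper half-plane, and the equation holds at every point of `[0,1]`. -/
structure IsCanonicalSolution (σ : unitInterval → unitInterval → ℝ)
    (m : ℍ → unitInterval → ℍ) : Prop where
  measurable : ∀ z, Measurable fun x => (m z x : ℂ)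
  bounded : ∀ z, ∃ C : ℝ, ∀ x, ‖(m z x : ℂ)‖ ≤ C
  equation : ∀ z x, -1 / (m z x : ℂ) = (z : ℂ) + kernelOp σ (fun y => (m z y : ℂ)) x

/-- The Stieltjes transform `z ↦ ∫ 1 / (t - z) dν(t)` on the upper half-plane, with the sign
for which it takes values in the upper half-plane. -/
def stieltjesTransform (ν : Measure ℝ) (z : ℍ) : ℂ :=
  ∫ t : ℝ, 1 / ((t : ℂ) - (z : ℂ)) ∂ν

/-- `μ = ∫₀¹ p_x dx`, where, for a solution `m` of the canonical equation and every
`x ∈ [0,1]`, the function `z ↦ m(z)(x)` is the Stieltjes transform of the probability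
measure `p_x`. -/
def IsLimitMeasure (σ : unitInterval → unitInterval → ℝ) (μ : ProbabilityMeasure ℝ) : Prop :=
  ∃ m : ℍ → unitInterval → ℍ, IsCanonicalSolution σ m ∧
    ∃ p : Kernel unitInterval ℝ, IsMarkovKernel p ∧
      (∀ z x, (m z x : ℂ) = stieltjesTransform (p x) z) ∧
      (μ : Measure ℝ) = Measure.bind volume p

/-- The measure `μ_σ`, that is, the measure singled out by `IsLimitMeasure σ`. -/
def limitMeasure (σ : unitInterval → unitInterval → ℝ) : ProbabilityMeasure ℝ :=
  Classical.epsilon (IsLimitMeasure σ)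

end

open Filter Topology BoundedContinuousFunction

/-! The fixed point iteration `m ↦ -1 / (z + S m)` is run on Markov kernels `p`, of which `m` is the
Stieltjes transform. At `x`, `S m` is the transform of the finite measure `∫ σ(x,y)² p_y dy`, and
`-1 / (z + w)` is the transform of a probability measure whenever `w` is that of a finite measure
(`exists_stieltjesTransform_eq`): for finitely many atoms it is a resolvent entry of a Hermitian
matrix, and the general case is a weak limit.

If `σ² ≤ K`, the bound `|m| ≤ 1 / Im z` makes the step a contraction with factor `1/2` in sup norm
where `(Im z)² ≥ 2K` (`IsCanonicalStep.norm_sub_le`), and changing `σ²` by at most `η` moves the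
fixed point there by at most `2η / (Im z)³`. This high region suffices: by analytic continuation and
Stieltjes inversion it determines the measure, and `|1 + z m| ≤ K / (Im z)²` gives tightness, so
that convergence there is weak convergence (`exists_tendsto_of_tendsto_stieltjesTransform`).
Existence, uniqueness and continuity all follow. -/

/-! ### Elementary bounds for Stieltjes transforms -/

lemma UpperHalfPlane.im_le_norm_ofReal_sub (z : ℍ) (t : ℝ) : z.im ≤ ‖(t : ℂ) - z‖ := by
  have h := Complex.abs_im_le_norm ((t : ℂ) - z)
  simp only [Complex.sub_im, Complex.ofReal_im, UpperHalfPlane.coe_im, zero_sub, abs_neg] at h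
  exact (le_abs_self _).trans h

lemma UpperHalfPlane.ofReal_sub_coe_ne_zero (z : ℍ) (t : ℝ) : (t : ℂ) - z ≠ 0 :=
  norm_pos_iff.1 (z.im_pos.trans_le (z.im_le_norm_ofReal_sub t))

lemma norm_one_div_ofReal_sub_le (z : ℍ) (t : ℝ) : ‖1 / ((t : ℂ) - z)‖ ≤ 1 / z.im := by
  rw [norm_div, norm_one]
  exact one_div_le_one_div_of_le z.im_pos (z.im_le_norm_ofReal_sub t)

lemma continuous_one_div_ofReal_sub (z : ℍ) : Continuous fun t : ℝ => 1 / ((t : ℂ) - z) := by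
  have := z.ofReal_sub_coe_ne_zero
  fun_prop (disch := exact this _)

/-- The bounded continuous function `t ↦ 1 / (t - z)`. -/
noncomputable def cauchyKernel (z : ℍ) : ℝ →ᵇ ℂ :=
  BoundedContinuousFunction.ofNormedAddCommGroup (fun t : ℝ => 1 / ((t : ℂ) - z))
    (continuous_one_div_ofReal_sub z) (1 / z.im) (norm_one_div_ofReal_sub_le z)

lemma integrable_one_div_ofReal_sub (ν : Measure ℝ) [IsFiniteMeasure ν] (z : ℍ) :
    Integrable (fun t : ℝ => 1 / ((t : ℂ) - z)) ν :=
  (cauchyKernel z).integrable ν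

lemma norm_stieltjesTransform_le (ν : Measure ℝ) [IsFiniteMeasure ν] (z : ℍ) :
    ‖stieltjesTransform ν z‖ ≤ ν.real Set.univ / z.im := by
  have := norm_integral_le_of_norm_le_const (μ := ν) (ae_of_all _ (norm_one_div_ofReal_sub_le z))
  refine this.trans_eq (by ring)

lemma im_one_div_ofReal_sub (z : ℍ) (t : ℝ) :
    (1 / ((t : ℂ) - z)).im = z.im / ((t - z.re) ^ 2 + z.im ^ 2) := by
  simp [Complex.inv_im, Complex.normSq_apply]
  ring

lemma im_stieltjesTransform (ν : Measure ℝ) [IsFiniteMeasure ν] (z : ℍ) :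
    (stieltjesTransform ν z).im = ∫ t, z.im / ((t - z.re) ^ 2 + z.im ^ 2) ∂ν := by
  have := integral_im (integrable_one_div_ofReal_sub ν z)
  simp only [RCLike.im_to_complex, im_one_div_ofReal_sub] at this
  exact this.symm

lemma im_stieltjesTransform_nonneg (ν : Measure ℝ) [IsFiniteMeasure ν] (z : ℍ) :
    0 ≤ (stieltjesTransform ν z).im := by
  rw [im_stieltjesTransform]
  have := z.im_pos
  exact integral_nonneg fun t => by positivity

lemma im_stieltjesTransform_pos (ν : Measure ℝ) [IsProbabilityMeasure ν] (z : ℍ) :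
    0 < (stieltjesTransform ν z).im := by
  rw [im_stieltjesTransform]
  have hz := z.im_pos
  have hpos : ∀ t : ℝ, 0 < z.im / ((t - z.re) ^ 2 + z.im ^ 2) := fun t => by positivity
  have hint : Integrable (fun t : ℝ => z.im / ((t - z.re) ^ 2 + z.im ^ 2)) ν := by
    simpa only [RCLike.im_to_complex, im_one_div_ofReal_sub]
      using (integrable_one_div_ofReal_sub ν z).im
  refine (integral_pos_iff_support_of_nonneg (fun t => (hpos t).le) hint).2 ?_
  rw [Function.support_eq_univ fun t => (hpos t).ne']
  simp

/-! ### Stieltjes inversion and its consequences -/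

/-- The point `E + i / (n + 1)`. -/
noncomputable def approachReal (n : ℕ) (E : ℝ) : ℍ :=
  ⟨⟨E, 1 / ((n : ℝ) + 1)⟩, by simp only; positivity⟩

@[simp] lemma approachReal_re (n : ℕ) (E : ℝ) : (approachReal n E).re = E := rfl

@[simp] lemma approachReal_im (n : ℕ) (E : ℝ) : (approachReal n E).im = 1 / ((n : ℝ) + 1) := rfl

lemma integrable_poisson {y : ℝ} (hy : 0 < y) (t : ℝ) :
    Integrable fun E : ℝ => y / ((t - E) ^ 2 + y ^ 2) := by
  have h := (integrable_inv_one_add_sq.comp_mul_left' (inv_ne_zero hy.ne')).comp_sub_right t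
  refine (h.const_mul (y⁻¹)).congr (ae_of_all _ fun E => ?_)
  simp only
  have : (t - E) ^ 2 + y ^ 2 ≠ 0 := by positivity
  have : 1 + (y⁻¹ * (E - t)) ^ 2 ≠ 0 := by positivity
  field_simp
  ring

/-- The substitution `E = t + y s` moves `y` out of the weight and into the argument of `f`, so that
as `y → 0` one integrable function dominates. -/
lemma integral_mul_poisson {y : ℝ} (hy : 0 < y) (t : ℝ) (f : ℝ → ℝ) :
    ∫ E, f E * (y / ((t - E) ^ 2 + y ^ 2)) = ∫ s, f (t + y * s) * (1 + s ^ 2)⁻¹ := by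
  have h := Measure.integral_comp_mul_left (fun u => f (t + u) * (y / (u ^ 2 + y ^ 2))) y
  have h2 := integral_add_left_eq_self (μ := volume)
    (fun E => f E * (y / ((t - E) ^ 2 + y ^ 2))) t
  rw [← h2]
  simp only [sub_add_cancel_left, neg_sq]
  rw [abs_of_pos (inv_pos.2 hy), smul_eq_mul, eq_comm, inv_mul_eq_iff_eq_mul₀ hy.ne'] at h
  rw [h, ← integral_const_mul]
  refine integral_congr_ae (ae_of_all _ fun s => ?_)
  simp only
  have : (y * s) ^ 2 + y ^ 2 ≠ 0 := by positivity
  have : 1 + s ^ 2 ≠ 0 := by positivity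
  field_simp
  ring

lemma integral_mul_im_stieltjesTransform (ν : Measure ℝ) [IsFiniteMeasure ν] (f : ℝ →ᵇ ℝ) (n : ℕ) :
    ∫ E, f E * (stieltjesTransform ν (approachReal n E)).im =
      ∫ t, (∫ s, f (t + 1 / ((n : ℝ) + 1) * s) * (1 + s ^ 2)⁻¹) ∂ν := by
  set y : ℝ := 1 / ((n : ℝ) + 1) with hy
  have hy0 : 0 < y := by positivity
  have hswap : ∀ t : ℝ, ∫ s, f (t + y * s) * (1 + s ^ 2)⁻¹ =
      ∫ E, f E * (y / ((t - E) ^ 2 + y ^ 2)) := fun t => (integral_mul_poisson hy0 t f).symm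
  simp only [im_stieltjesTransform, approachReal_re, approachReal_im, ← integral_const_mul, ← hy,
    hswap]
  refine integral_integral_swap (μ := volume) (ν := ν)
    (f := fun E t => f E * (y / ((t - E) ^ 2 + y ^ 2))) ?_
  have hmeas : Measurable fun p : ℝ × ℝ => y / ((p.2 - p.1) ^ 2 + y ^ 2) := by fun_prop
  -- For each `t` the Poisson kernel has mass `π` in `E`, and `ν` is finite.
  have hint : Integrable (fun p : ℝ × ℝ => y / ((p.2 - p.1) ^ 2 + y ^ 2)) (volume.prod ν) := by
    rw [integrable_prod_iff' hmeas.aestronglyMeasurable]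
    refine ⟨ae_of_all _ fun t => integrable_poisson hy0 t, ?_⟩
    refine (integrable_const Real.pi).congr (ae_of_all _ fun t => ?_)
    have h := integral_mul_poisson hy0 t (fun _ => 1)
    simp only [one_mul, integral_univ_inv_one_add_sq] at h
    rw [← h]
    refine integral_congr_ae (ae_of_all _ fun s => ?_)
    simp only
    rw [Real.norm_of_nonneg (by positivity)]
  exact hint.bdd_mul (c := ‖f‖) (f.continuous.comp continuous_fst).aestronglyMeasurable
    (ae_of_all _ fun p => f.norm_coe_le_norm _)

/-- **Stieltjes inversion**, tested against bounded continuous functions. -/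
theorem tendsto_integral_mul_im_stieltjesTransform (ν : Measure ℝ) [IsFiniteMeasure ν]
    (f : ℝ →ᵇ ℝ) :
    Tendsto (fun n : ℕ => ∫ E, f E * (stieltjesTransform ν (approachReal n E)).im) atTop
      (𝓝 (∫ t, f t * Real.pi ∂ν)) := by
  simp only [integral_mul_im_stieltjesTransform]
  have hb : ∀ (n : ℕ) (t s : ℝ), ‖f (t + 1 / ((n : ℝ) + 1) * s) * (1 + s ^ 2)⁻¹‖
      ≤ ‖f‖ * (1 + s ^ 2)⁻¹ := fun n t s => by
    rw [norm_mul, Real.norm_of_nonneg (by positivity : (0 : ℝ) ≤ (1 + s ^ 2)⁻¹)]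
    gcongr
    exact f.norm_coe_le_norm _
  have hbi : Integrable fun s : ℝ => ‖f‖ * (1 + s ^ 2)⁻¹ :=
    integrable_inv_one_add_sq.const_mul _
  refine tendsto_integral_of_dominated_convergence (μ := ν) (fun _ => ‖f‖ * Real.pi) (fun n => ?_)
    (integrable_const _) (fun n => ae_of_all _ fun t => ?_) (ae_of_all _ fun t => ?_)
  · refine StronglyMeasurable.aestronglyMeasurable ?_
    refine StronglyMeasurable.integral_prod_right
      (f := fun t s : ℝ => f (t + 1 / ((n : ℝ) + 1) * s) * (1 + s ^ 2)⁻¹) ?_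
    have := f.continuous
    refine Measurable.stronglyMeasurable ?_
    fun_prop
  · rw [← integral_univ_inv_one_add_sq, ← integral_const_mul]
    exact norm_integral_le_of_norm_le hbi (ae_of_all _ fun s => hb n t s)
  · rw [← integral_univ_inv_one_add_sq, ← integral_const_mul]
    refine tendsto_integral_of_dominated_convergence _ (fun n => ?_) hbi
      (fun n => ae_of_all _ fun s => hb n t s) (ae_of_all _ fun s => ?_)
    · have := f.continuous
      exact Measurable.aestronglyMeasurable (by fun_prop)
    · have h0 : Tendsto (fun n : ℕ => t + 1 / ((n : ℝ) + 1) * s) atTop (𝓝 (t + 0 * s)) :=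
        (tendsto_one_div_add_atTop_nhds_zero_nat.mul_const s).const_add t
      rw [zero_mul, add_zero] at h0
      exact ((f.continuous.tendsto t).comp h0).mul_const _

/-- A finite measure is determined by its Stieltjes transform. -/
theorem eq_of_stieltjesTransform_eq {μ ν : Measure ℝ} [IsFiniteMeasure μ] [IsFiniteMeasure ν]
    (h : ∀ z, stieltjesTransform μ z = stieltjesTransform ν z) : μ = ν := by
  refine ext_of_forall_integral_eq_of_IsFiniteMeasure fun f => ?_
  have h1 := tendsto_integral_mul_im_stieltjesTransform μ f
  simp only [h] at h1
  have h2 := tendsto_nhds_unique h1 (tendsto_integral_mul_im_stieltjesTransform ν f)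
  simpa [integral_mul_const, Real.pi_ne_zero] using h2

lemma resolventTransform_coe (ν : Measure ℝ) (z : ℍ) :
    resolventTransform ν (z : ℂ) = stieltjesTransform ν z := by
  simp [resolventTransform, stieltjesTransform, resolvent, Ring.inverse_eq_inv']

lemma differentiableOn_resolventTransform (ν : Measure ℝ) [IsFiniteMeasure ν] :
    DifferentiableOn ℂ (resolventTransform ν) {z : ℂ | 0 < z.im} := by
  intro z hz
  refine (hasDerivAt_resolventTransform z ?_).differentiableAt.differentiableWithinAt
  rintro ⟨t, -, rfl⟩
  simp at hz

/-- Two Stieltjes transforms that agree far from the real axis agree. -/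
theorem stieltjesTransform_eq_of_eq_of_lt_im {μ ν : Measure ℝ} [IsFiniteMeasure μ]
    [IsFiniteMeasure ν] {Y : ℝ}
    (h : ∀ z : ℍ, Y < z.im → stieltjesTransform μ z = stieltjesTransform ν z) (z : ℍ) :
    stieltjesTransform μ z = stieltjesTransform ν z := by
  have hopen : IsOpen {z : ℂ | 0 < z.im} := isOpen_lt continuous_const Complex.continuous_im
  have hconv : Convex ℝ {z : ℂ | 0 < z.im} := convex_halfSpace_im_gt 0
  -- A base point above both `Y` and the real axis: the transforms agree near it, and the identity
  -- theorem does the rest.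
  set w : ℂ := ⟨0, max Y 0 + 1⟩
  have hw : w ∈ {z : ℂ | max Y 0 < z.im} := lt_add_one (max Y 0)
  have hev : resolventTransform μ =ᶠ[𝓝 w] resolventTransform ν := by
    filter_upwards [(isOpen_lt continuous_const Complex.continuous_im).mem_nhds hw] with u hu
    have := h ⟨u, (le_max_right _ _).trans_lt hu⟩ ((le_max_left _ _).trans_lt hu)
    rwa [← resolventTransform_coe, ← resolventTransform_coe] at this
  have := ((differentiableOn_resolventTransform μ).analyticOnNhd
    hopen).eqOn_of_preconnected_of_eventuallyEq
    ((differentiableOn_resolventTransform ν).analyticOnNhd hopen) hconv.isPreconnected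
    ((le_max_right Y 0).trans_lt hw : 0 < w.im) hev z.im_pos
  rwa [resolventTransform_coe, resolventTransform_coe] at this

/-- Continuity in `E` and measurability in `x` together give the joint measurability needed to
integrate over `E`. -/
lemma continuous_stieltjesTransform_approachReal (ν : Measure ℝ) [IsFiniteMeasure ν] (n : ℕ) :
    Continuous fun E => stieltjesTransform ν (approachReal n E) := by
  simp only [← resolventTransform_coe]
  refine (differentiableOn_resolventTransform ν).continuousOn.comp_continuous ?_
    fun E => (approachReal n E).im_pos
  have : (fun E : ℝ => (approachReal n E : ℂ)) = fun E : ℝ => (E : ℂ) +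
      ((1 / ((n : ℝ) + 1) : ℝ) : ℂ) * Complex.I := by
    ext E
    apply Complex.ext
    · simp
    · rw [Complex.add_im, Complex.im_ofReal_mul]
      simp
  rw [this]
  fun_prop

/-- A family of probability measures is measurable if its Stieltjes transforms are. -/
theorem measurable_of_measurable_stieltjesTransform {α : Type*} [MeasurableSpace α]
    (p : α → Measure ℝ) [∀ x, IsProbabilityMeasure (p x)]
    (h : ∀ z, Measurable fun x => stieltjesTransform (p x) z) : Measurable p := by
  have hf : ∀ f : ℝ →ᵇ ℝ, Measurable fun x => ∫ t, f t ∂p x := by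
    intro f
    have hlim : Measurable fun x => ∫ t, f t * Real.pi ∂p x := by
      refine measurable_of_tendsto_metrizable
        (f := fun (n : ℕ) x => ∫ E, f E * (stieltjesTransform (p x) (approachReal n E)).im)
        (fun n => ?_) (tendsto_pi_nhds.2 fun x => tendsto_integral_mul_im_stieltjesTransform (p x) f)
      have hj : Measurable (Function.uncurry fun (E : ℝ) x =>
          stieltjesTransform (p x) (approachReal n E)) :=
        measurable_uncurry_of_continuous_of_measurable
          (fun x => continuous_stieltjesTransform_approachReal (p x) n) (fun E => h _)
      have hj' : Measurable fun q : α × ℝ =>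
          f q.2 * (stieltjesTransform (p q.1) (approachReal n q.2)).im :=
        (f.continuous.measurable.comp measurable_snd).mul
          (Complex.measurable_im.comp (hj.comp measurable_swap))
      exact hj'.stronglyMeasurable.integral_prod_right'.measurable
    simpa [integral_mul_const, Real.pi_ne_zero] using hlim.mul_const (Real.pi⁻¹)
  -- Closed sets form a generating π-system, and their measures are limits of integrals of thickened
  -- indicators, which `hf` covers.
  refine Measurable.measure_of_isPiSystem_of_isProbabilityMeasure
    (S := {F : Set ℝ | IsClosed F}) ?_ isPiSystem_isClosed fun F hF => ?_
  · exact (BorelSpace.measurable_eq (α := ℝ)).trans borel_eq_generateFrom_isClosed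
  · have hreal : Measurable fun x => (p x).real F := by
      refine measurable_of_tendsto_metrizable
        (f := fun (n : ℕ) x => ∫ t, (thickenedIndicator (δ := 1 / ((n : ℝ) + 1))
          (by positivity) F t : ℝ) ∂p x)
        (fun n => ?_) (tendsto_pi_nhds.2 fun x =>
          tendsto_integral_thickenedIndicator_of_isClosed (p x) hF (fun n => by positivity)
            tendsto_one_div_add_atTop_nhds_zero_nat)
      exact hf (BoundedContinuousFunction.ofNormedAddCommGroup
        (fun t => (thickenedIndicator (δ := 1 / ((n : ℝ) + 1)) (by positivity) F t : ℝ))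
        (by fun_prop) 1 fun t => by
          rw [NNReal.norm_eq]
          exact_mod_cast thickenedIndicator_le_one _ F t)
    simpa using hreal.ennreal_ofReal

/-! ### Tightness and the continuity theorem -/

/-- The Stieltjes transform is a continuous function of the measure. -/
lemma continuous_stieltjesTransform (z : ℍ) :
    Continuous fun μ : ProbabilityMeasure ℝ => stieltjesTransform (μ : Measure ℝ) z := by
  rw [continuous_iff_continuousAt]
  intro μ
  exact (ProbabilityMeasure.tendsto_iff_forall_integral_rclike_tendsto ℂ).1 tendsto_id
    (cauchyKernel z)

/-- The point `i y`. -/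
noncomputable def imaginaryPoint (y : ℝ) (hy : 0 < y) : ℍ := ⟨⟨0, y⟩, hy⟩

/-- At `z = iy` the integrand on the right has real part `t² / (t² + y²)`, which is at least `1/2`
for `|t| ≥ y`; hence the left side bounds the tail. -/
lemma one_add_mul_stieltjesTransform (μ : Measure ℝ) [IsProbabilityMeasure μ] (z : ℍ) :
    1 + z * stieltjesTransform μ z = ∫ t : ℝ, (t : ℂ) / (t - z) ∂μ := by
  rw [stieltjesTransform, ← integral_const_mul]
  have h1 : (1 : ℂ) = ∫ t : ℝ, 1 ∂μ := by simp
  nth_rw 1 [h1]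
  rw [← integral_add (integrable_const _) ((integrable_one_div_ofReal_sub μ z).const_mul _)]
  refine integral_congr_ae (ae_of_all _ fun t => ?_)
  have := z.ofReal_sub_coe_ne_zero t
  simp only
  field_simp
  ring

/-- The behaviour of the Stieltjes transform at `i ∞` controls the tails of the measure. -/
theorem measureReal_compl_Icc_le (μ : Measure ℝ) [IsProbabilityMeasure μ] {C y : ℝ} (hy : 0 < y)
    (h : ‖1 + (imaginaryPoint y hy : ℂ) * stieltjesTransform μ (imaginaryPoint y hy)‖ ≤ C / y ^ 2) :
    μ.real (Set.Icc (-y) y)ᶜ ≤ 2 * C / y ^ 2 := by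
  set z := imaginaryPoint y hy
  have hpt : ∀ t : ℝ, ((t : ℂ) / (t - z)).re = t ^ 2 / (t ^ 2 + y ^ 2) := fun t => by
    simp [Complex.div_re, Complex.normSq_apply, z, imaginaryPoint]
    ring
  have hint : Integrable (fun t : ℝ => (t : ℂ) / (t - z)) μ := by
    refine ((integrable_const (1 : ℂ)).add
      ((integrable_one_div_ofReal_sub μ z).const_mul z)).congr (ae_of_all _ fun t => ?_)
    have := z.ofReal_sub_coe_ne_zero t
    simp only [Pi.add_apply]
    field_simp
    ring
  have hre := integral_re hint
  have hintre := hint.re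
  simp only [RCLike.re_to_complex, hpt] at hre hintre
  rw [← one_add_mul_stieltjesTransform] at hre
  have hle : ∫ t, t ^ 2 / (t ^ 2 + y ^ 2) ∂μ ≤ C / y ^ 2 :=
    hre.trans_le ((Complex.re_le_norm _).trans h)
  have hmeas : MeasurableSet (Set.Icc (-y) y)ᶜ := measurableSet_Icc.compl
  have hind : ∫ t, (Set.Icc (-y) y)ᶜ.indicator (fun _ => (1 / 2 : ℝ)) t ∂μ
      ≤ ∫ t, t ^ 2 / (t ^ 2 + y ^ 2) ∂μ := by
    refine integral_mono ((integrable_const _).indicator hmeas) hintre fun t => ?_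
    by_cases ht : t ∈ (Set.Icc (-y) y)ᶜ
    · rw [Set.indicator_of_mem ht]
      have hty : y ^ 2 ≤ t ^ 2 := by
        rw [Set.mem_compl_iff, Set.mem_Icc, ← abs_le, not_le] at ht
        rw [← sq_abs t]
        gcongr
      simp only
      rw [div_le_div_iff₀ (by norm_num) (by positivity)]
      linarith
    · rw [Set.indicator_of_notMem ht]
      positivity
  rw [integral_indicator_const _ hmeas, smul_eq_mul] at hind
  have := hind.trans hle
  rw [mul_div_assoc]
  linarith

/-- A set of probability measures with uniformly controlled Stieltjes transforms along the
imaginary axis is tight. -/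
theorem isTightMeasureSet_of_norm_stieltjesTransform_le {S : Set (Measure ℝ)}
    (hS : ∀ μ ∈ S, IsProbabilityMeasure μ) {C : ℝ}
    (h : ∀ μ ∈ S, ∀ y (hy : 0 < y),
      ‖1 + (imaginaryPoint y hy : ℂ) * stieltjesTransform μ (imaginaryPoint y hy)‖ ≤ C / y ^ 2) :
    IsTightMeasureSet S := by
  rw [isTightMeasureSet_iff_exists_isCompact_measure_compl_le]
  intro ε hε
  have hlim : Tendsto (fun y : ℝ => ENNReal.ofReal (2 * C / y ^ 2)) atTop (𝓝 0) := by
    rw [← ENNReal.ofReal_zero]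
    exact ENNReal.tendsto_ofReal ((tendsto_pow_atTop two_ne_zero).const_div_atTop _)
  obtain ⟨y, hy0, hy⟩ := ((eventually_gt_atTop 0).and (hlim.eventually_lt_const hε)).exists
  refine ⟨Set.Icc (-y) y, isCompact_Icc, fun μ hμ => ?_⟩
  have := hS μ hμ
  rw [← ofReal_measureReal]
  exact (ENNReal.ofReal_le_ofReal (measureReal_compl_Icc_le μ hy0 (h μ hμ y hy0))).trans hy.le

/-- Continuity theorem for Stieltjes transforms: convergence far from the real axis and control
along the imaginary axis yield weak convergence. -/
theorem exists_tendsto_of_tendsto_stieltjesTransform {μ : ℕ → ProbabilityMeasure ℝ} {C Y : ℝ}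
    (hC : ∀ n y (hy : 0 < y), ‖1 + (imaginaryPoint y hy : ℂ) *
      stieltjesTransform (μ n : Measure ℝ) (imaginaryPoint y hy)‖ ≤ C / y ^ 2)
    {g : ℍ → ℂ} (hg : ∀ z : ℍ, Y < z.im →
      Tendsto (fun n => stieltjesTransform (μ n : Measure ℝ) z) atTop (𝓝 (g z))) :
    ∃ ν : ProbabilityMeasure ℝ, Tendsto μ atTop (𝓝 ν) := by
  have hcomp : IsCompact (closure (Set.range μ)) := by
    refine isCompact_closure_of_isTightMeasureSet
      (isTightMeasureSet_of_norm_stieltjesTransform_le (C := C) ?_ ?_)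
    · rintro _ ⟨ν, -, rfl⟩
      infer_instance
    · rintro _ ⟨_, ⟨n, rfl⟩, rfl⟩
      exact hC n
  have hmem : ∀ᶠ n in atTop, μ n ∈ closure (Set.range μ) :=
    Eventually.of_forall fun n => subset_closure ⟨n, rfl⟩
  -- All cluster points have the transform `g` above height `Y`, so they coincide; in a compact set
  -- this forces convergence.
  have hclust : ∀ ν, MapClusterPt ν atTop μ → ∀ z : ℍ, Y < z.im →
      stieltjesTransform (ν : Measure ℝ) z = g z := by
    intro ν hν z hz
    have := hν.continuousAt_comp (continuous_stieltjesTransform z).continuousAt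
    exact @eq_of_nhds_neBot _ _ _ _ _ (this.neBot.mono (inf_le_inf_left _ (hg z hz)))
  obtain ⟨ν, -, hν⟩ := hcomp.exists_clusterPt (f := map μ atTop) (by simpa using hmem)
  refine ⟨ν, hcomp.tendsto_nhds_of_unique_mapClusterPt hmem fun ν' _ hν' => ?_⟩
  have heq : (ν' : Measure ℝ) = ν := eq_of_stieltjesTransform_eq
    (stieltjesTransform_eq_of_eq_of_lt_im (Y := Y) fun z hz =>
      (hclust ν' hν' z hz).trans (hclust ν hν z hz).symm)
  exact Subtype.ext heq

/-! ### The map `w ↦ -1 / (z + w)` on Stieltjes transforms -/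

/-- `ρ` puts mass `|⟨u_j, e⟩|²` at the eigenvalue of `u_j`. The vector `v` is `(T - z)⁻¹ e`,
described by its equation so that no inverse is needed. -/
lemma LinearMap.IsSymmetric.exists_spectralMeasure {E : Type*} [NormedAddCommGroup E]
    [InnerProductSpace ℂ E] [FiniteDimensional ℂ E] {T : E →ₗ[ℂ] E} (hT : T.IsSymmetric) {e : E}
    (he : ‖e‖ = 1) :
    ∃ ρ : Measure ℝ, IsProbabilityMeasure ρ ∧ ∀ (z : ℍ) (v : E), T v = (z : ℂ) • v + e →
      stieltjesTransform ρ z = inner ℂ e v := by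
  set u := hT.eigenvectorBasis rfl
  set l := hT.eigenvalues rfl
  set w : Fin (Module.finrank ℂ E) → ℝ := fun j => ‖inner ℂ (u j) e‖ ^ 2
  have hw : ∑ j, w j = 1 := by
    simp only [w, u.sum_sq_norm_inner_right, he, one_pow]
  refine ⟨∑ j, ENNReal.ofReal (w j) • Measure.dirac (l j), ⟨?_⟩, fun z v hv => ?_⟩
  · simp only [Measure.coe_finsetSum, Finset.sum_apply, Measure.smul_apply, measure_univ,
      smul_eq_mul, mul_one]
    rw [← ENNReal.ofReal_sum_of_nonneg fun j _ => by positivity, hw, ENNReal.ofReal_one]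
  · rw [stieltjesTransform, integral_finsetSum_measure fun j _ =>
      ((integrable_one_div_ofReal_sub (Measure.dirac (l j)) z).smul_measure ENNReal.ofReal_ne_top),
      ← u.sum_inner_mul_inner]
    refine Finset.sum_congr rfl fun j _ => ?_
    rw [integral_smul_measure, integral_dirac, ENNReal.toReal_ofReal (by positivity)]
    have h1 : inner ℂ (u j) (T v) = (l j : ℂ) * inner ℂ (u j) v := by
      rw [← hT, hT.apply_eigenvectorBasis, inner_smul_left]
      simp [l, u]
    rw [hv, inner_add_right, inner_smul_right] at h1
    have h2 : inner ℂ (u j) e = ((l j : ℂ) - z) * inner ℂ (u j) v := by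
      linear_combination h1
    have hne := z.ofReal_sub_coe_ne_zero (l j)
    have h3 : inner ℂ e (u j) * inner ℂ (u j) e = ((w j : ℝ) : ℂ) := by
      rw [← inner_conj_symm e, Complex.conj_mul']
      simp [w]
    rw [Complex.real_smul, ← h3, h2]
    field_simp

lemma add_stieltjesTransform_ne_zero (q : Measure ℝ) [IsFiniteMeasure q] (z : ℍ) :
    (z : ℂ) + stieltjesTransform q z ≠ 0 := by
  intro h
  have := congrArg Complex.im h
  simp only [Complex.add_im, UpperHalfPlane.coe_im, Complex.zero_im] at this
  linarith [z.im_pos, im_stieltjesTransform_nonneg q z]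

/-- Schur complement: for the arrow matrix with corner `0`, border `b` and diagonal `d`, the right
side is the corner entry of `(A - z)⁻¹`, and `ρ` is the spectral measure at the corner vector. -/
lemma exists_stieltjesTransform_eq_of_fintype {ι : Type*} [Fintype ι] (b d : ι → ℝ) :
    ∃ ρ : Measure ℝ, IsProbabilityMeasure ρ ∧ ∀ z : ℍ,
      (z : ℂ) + ∑ i, (b i : ℂ) ^ 2 * (1 / ((d i : ℂ) - z)) ≠ 0 →
      stieltjesTransform ρ z = -1 / (z + ∑ i, (b i : ℂ) ^ 2 * (1 / ((d i : ℂ) - z))) := by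
  classical
  let A : Matrix (Option ι) (Option ι) ℂ := Matrix.of fun k l => match k, l with
    | none, none => 0
    | none, some i => b i
    | some i, none => b i
    | some i, some j => if i = j then (d i : ℂ) else 0
  have hA : A.IsHermitian := by
    ext k l
    rcases k with _ | i <;> rcases l with _ | j <;> simp [A, Matrix.conjTranspose_apply]
    by_cases h : i = j
    · subst h
      simp
    · simp [h, Ne.symm h]
  have hT := Matrix.isSymmetric_toEuclideanLin_iff.2 hA
  obtain ⟨ρ, hρ, h⟩ := hT.exists_spectralMeasure
    (e := EuclideanSpace.single (none : Option ι) (1 : ℂ)) (by simp)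
  refine ⟨ρ, hρ, fun z hz => ?_⟩
  set c : ℂ := -1 / (z + ∑ i, (b i : ℂ) ^ 2 * (1 / ((d i : ℂ) - z)))
  -- The corner row of `A v = z v + e`, for the `v` found by solving the other rows in terms of its
  -- corner entry `c`.
  have hc' : ∑ i, (b i : ℂ) * (-c * b i * (1 / ((d i : ℂ) - z))) = z * c + 1 := by
    have h1 : ∑ i, (b i : ℂ) * (-c * b i * (1 / ((d i : ℂ) - z))) =
        -c * ∑ i, (b i : ℂ) ^ 2 * (1 / ((d i : ℂ) - z)) := by
      rw [Finset.mul_sum]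
      exact Finset.sum_congr rfl fun i _ => by ring
    have h2 : c * (z + ∑ i, (b i : ℂ) ^ 2 * (1 / ((d i : ℂ) - z))) = -1 := div_mul_cancel₀ _ hz
    rw [h1]
    linear_combination -h2
  let v : EuclideanSpace ℂ (Option ι) := WithLp.toLp 2 fun k => match k with
    | none => c
    | some i => -c * b i * (1 / ((d i : ℂ) - z))
  rw [h z v]
  · simp [v, EuclideanSpace.inner_single_left]
  · ext k
    rcases k with _ | i
    · simp [Matrix.toLpLin_apply, Matrix.mulVec, dotProduct, Fintype.sum_option, A, v]
      simpa using hc'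
    · have := z.ofReal_sub_coe_ne_zero (d i)
      simp [Matrix.toLpLin_apply, Matrix.mulVec, dotProduct, Fintype.sum_option, A, v]
      field_simp
      ring

lemma MeasureTheory.SimpleFunc.integral_comp_eq_sum (q : Measure ℝ) [IsFiniteMeasure q]
    (s : SimpleFunc ℝ ℝ) (g : ℝ → ℂ) :
    ∫ t, g (s t) ∂q = ∑ r : s.range, (q.real (s ⁻¹' {(r : ℝ)}) : ℂ) * g r := by
  have hpt : ∀ t, g (s t) = ∑ r ∈ s.range, (s ⁻¹' {r}).indicator (fun _ => g r) t := fun t => by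
    rw [Finset.sum_eq_single (s t)]
    · simp
    · intro r _ hr
      exact Set.indicator_of_notMem (fun h => hr (Eq.symm h)) _
    · intro h
      exact absurd (s.mem_range_self t) h
  simp only [hpt]
  rw [integral_finsetSum _ fun r _ => (integrable_const _).indicator (s.measurableSet_fiber r),
    ← Finset.sum_coe_sort s.range]
  refine Finset.sum_congr rfl fun r _ => ?_
  rw [integral_indicator_const _ (s.measurableSet_fiber r), Complex.real_smul]

/-- The equation gives `1 + z m = -m w`, and both factors are `O(1 / Im z)`. -/
lemma norm_one_add_mul_le {q ρ : Measure ℝ} [IsFiniteMeasure q] [IsProbabilityMeasure ρ] {z : ℍ}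
    (h : stieltjesTransform ρ z = -1 / (z + stieltjesTransform q z)) :
    ‖1 + z * stieltjesTransform ρ z‖ ≤ q.real Set.univ / z.im ^ 2 := by
  have hne := add_stieltjesTransform_ne_zero q z
  have h1 : 1 + z * stieltjesTransform ρ z = -(stieltjesTransform ρ z * stieltjesTransform q z) := by
    rw [h]
    field_simp
    ring
  rw [h1, norm_neg, norm_mul]
  have h2 := norm_stieltjesTransform_le ρ z
  rw [probReal_univ] at h2
  calc _ ≤ 1 / z.im * (q.real Set.univ / z.im) :=
        mul_le_mul h2 (norm_stieltjesTransform_le q z) (norm_nonneg _)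
          (by have := z.im_pos; positivity)
    _ = _ := by ring

/-- The map `w ↦ -1 / (z + w)` turns Stieltjes transforms of finite measures into Stieltjes
transforms of probability measures. -/
theorem exists_stieltjesTransform_eq (q : Measure ℝ) [IsFiniteMeasure q] :
    ∃ ρ : ProbabilityMeasure ℝ, ∀ z,
      stieltjesTransform (ρ : Measure ℝ) z = -1 / (z + stieltjesTransform q z) := by
  -- The push-forward of `q` under a simple function has finitely many atoms; the square roots of
  -- their masses are the border entries of the arrow matrix.
  let s : ℕ → SimpleFunc ℝ ℝ := SimpleFunc.approxOn id measurable_id Set.univ 0 trivial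
  have hs : ∀ t, Tendsto (fun n => s n t) atTop (𝓝 t) := fun t =>
    SimpleFunc.tendsto_approxOn measurable_id (Set.mem_univ 0) (by simp)
  have hst : ∀ n z, stieltjesTransform (q.map (s n)) z = ∫ t, 1 / ((s n t : ℂ) - z) ∂q := fun n z =>
    integral_map (s n).measurable.aemeasurable
      (continuous_one_div_ofReal_sub z).aestronglyMeasurable
  have hex : ∀ n, ∃ ρ : ProbabilityMeasure ℝ, ∀ z,
      stieltjesTransform (ρ : Measure ℝ) z = -1 / (z + stieltjesTransform (q.map (s n)) z) := by
    intro n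
    obtain ⟨ρ, hρ, h⟩ := exists_stieltjesTransform_eq_of_fintype
      (fun r : (s n).range => √(q.real (s n ⁻¹' {(r : ℝ)}))) (fun r => r)
    refine ⟨⟨ρ, hρ⟩, fun z => ?_⟩
    have hsum : ∑ r : (s n).range, ((√(q.real (s n ⁻¹' {(r : ℝ)})) : ℝ) : ℂ) ^ 2 *
        (1 / (((r : ℝ) : ℂ) - z)) = stieltjesTransform (q.map (s n)) z := by
      rw [hst, SimpleFunc.integral_comp_eq_sum q (s n) fun r => 1 / ((r : ℂ) - z)]
      refine Finset.sum_congr rfl fun r _ => ?_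
      rw [← Complex.ofReal_pow, Real.sq_sqrt measureReal_nonneg]
    rw [← hsum]
    refine h z ?_
    rw [hsum]
    exact add_stieltjesTransform_ne_zero _ z
  choose ρ hρ using hex
  have hlim : ∀ z, Tendsto (fun n => stieltjesTransform (ρ n : Measure ℝ) z) atTop
      (𝓝 (-1 / (z + stieltjesTransform q z))) := by
    intro z
    simp only [hρ]
    refine Tendsto.div tendsto_const_nhds (Tendsto.const_add _ ?_)
      (add_stieltjesTransform_ne_zero q z)
    simp only [hst]
    refine tendsto_integral_of_dominated_convergence (fun _ => 1 / z.im) (fun n => ?_)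
      (integrable_const _) (fun n => ae_of_all _ fun t => norm_one_div_ofReal_sub_le z _)
      (ae_of_all _ fun t => ?_)
    · exact ((continuous_one_div_ofReal_sub z).measurable.comp
        (s n).measurable).aestronglyMeasurable
    · exact ((continuous_one_div_ofReal_sub z).tendsto t).comp (hs t)
  -- Push-forward preserves total mass, so the tail bound is uniform in `n`.
  have htail : ∀ n y (hy : 0 < y), ‖1 + (imaginaryPoint y hy : ℂ) *
      stieltjesTransform (ρ n : Measure ℝ) (imaginaryPoint y hy)‖ ≤ q.real Set.univ / y ^ 2 := by
    intro n y hy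
    have h := norm_one_add_mul_le (hρ n (imaginaryPoint y hy))
    rwa [map_measureReal_apply (s n).measurable MeasurableSet.univ, Set.preimage_univ] at h
  obtain ⟨ν, hν⟩ := exists_tendsto_of_tendsto_stieltjesTransform (Y := 0) htail fun z _ => hlim z
  exact ⟨ν, fun z => tendsto_nhds_unique
    (((continuous_stieltjesTransform z).tendsto ν).comp hν) (hlim z)⟩

/-! ### Mixtures of measures and the operator `S` -/

lemma stieltjesTransform_bind {α : Type*} [MeasurableSpace α] (l : Measure α) [IsFiniteMeasure l]
    (p : Kernel α ℝ) [IsMarkovKernel p] (z : ℍ) :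
    stieltjesTransform (Measure.bind l p) z = ∫ x, stieltjesTransform (p x) z ∂l := by
  have hint : Integrable (fun t : ℝ => 1 / ((t : ℂ) - z)) ((p ∘ₖ Kernel.const Unit l) ()) :=
    integrable_one_div_ofReal_sub _ z
  rw [Measure.comp_eq_comp_const_apply, stieltjesTransform, Kernel.integral_comp hint,
    Kernel.const_apply]
  rfl

lemma measurable_stieltjesTransform {α : Type*} [MeasurableSpace α] (p : Kernel α ℝ) (z : ℍ) :
    Measurable fun x => stieltjesTransform (p x) z :=
  ((continuous_one_div_ofReal_sub z).stronglyMeasurable.integral_kernel (κ := p)).measurable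

lemma norm_stieltjesTransform_le_one_div (ν : Measure ℝ) [IsProbabilityMeasure ν] (z : ℍ) :
    ‖stieltjesTransform ν z‖ ≤ 1 / z.im := by
  simpa using norm_stieltjesTransform_le ν z

lemma IsBoundedMeasurable.exists_sq_le {σ : unitInterval → unitInterval → ℝ}
    (hσ : IsBoundedMeasurable σ) : ∃ K : ℝ, 0 ≤ K ∧ ∀ x y, σ x y ^ 2 ≤ K := by
  obtain ⟨C, hC⟩ := hσ.bounded
  exact ⟨C ^ 2, sq_nonneg C, fun x y => sq_le_sq' (neg_le_of_abs_le (hC x y)) (le_of_abs_le (hC x y))⟩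

lemma IsBoundedMeasurable.measurable_right {σ : unitInterval → unitInterval → ℝ}
    (hσ : IsBoundedMeasurable σ) (x : unitInterval) : Measurable (σ x) :=
  hσ.measurable.comp measurable_prodMk_left

lemma measurable_kernelOp {σ : unitInterval → unitInterval → ℝ} (hσ : IsBoundedMeasurable σ)
    {f : unitInterval → ℂ} (hf : Measurable f) : Measurable (kernelOp σ f) := by
  have h : Measurable fun q : unitInterval × unitInterval =>
      ((σ q.1 q.2 ^ 2 : ℝ) : ℂ) * f q.2 :=
    (Complex.measurable_ofReal.comp (hσ.measurable.pow_const 2)).mul (hf.comp measurable_snd)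
  exact h.stronglyMeasurable.integral_prod_right'.measurable

/-- The measure `∫ σ(x,y)² p_y dy`. -/
noncomputable def mixtureMeasure (σ : unitInterval → unitInterval → ℝ) (p : Kernel unitInterval ℝ)
    (x : unitInterval) : Measure ℝ :=
  Measure.bind (volume.withDensity fun y => ENNReal.ofReal (σ x y ^ 2)) p

lemma mixtureMeasure_univ_le {σ : unitInterval → unitInterval → ℝ} {K : ℝ}
    (hK : ∀ x y, σ x y ^ 2 ≤ K) (p : Kernel unitInterval ℝ) [IsMarkovKernel p] (x : unitInterval) :
    mixtureMeasure σ p x Set.univ ≤ ENNReal.ofReal K := by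
  rw [mixtureMeasure, Measure.bind_apply MeasurableSet.univ p.aemeasurable]
  simp only [measure_univ, lintegral_const, one_mul]
  rw [withDensity_apply _ MeasurableSet.univ, Measure.restrict_univ]
  calc _ ≤ ∫⁻ _ : unitInterval, ENNReal.ofReal K :=
        lintegral_mono fun y => ENNReal.ofReal_le_ofReal (hK x y)
    _ = _ := by simp

lemma isFiniteMeasure_mixtureMeasure {σ : unitInterval → unitInterval → ℝ} {K : ℝ}
    (hK : ∀ x y, σ x y ^ 2 ≤ K) (p : Kernel unitInterval ℝ) [IsMarkovKernel p] (x : unitInterval) :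
    IsFiniteMeasure (mixtureMeasure σ p x) :=
  ⟨(mixtureMeasure_univ_le hK p x).trans_lt ENNReal.ofReal_lt_top⟩

lemma stieltjesTransform_mixtureMeasure {σ : unitInterval → unitInterval → ℝ}
    (hσ : IsBoundedMeasurable σ) (p : Kernel unitInterval ℝ) [IsMarkovKernel p] (x : unitInterval)
    (z : ℍ) :
    stieltjesTransform (mixtureMeasure σ p x) z =
      kernelOp σ (fun y => stieltjesTransform (p y) z) x := by
  obtain ⟨K, -, hK⟩ := hσ.exists_sq_le
  have : IsFiniteMeasure (volume.withDensity fun y => ENNReal.ofReal (σ x y ^ 2)) := by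
    refine isFiniteMeasure_withDensity_ofReal (Integrable.hasFiniteIntegral (Integrable.of_bound
      ((hσ.measurable_right x).pow_const 2).aestronglyMeasurable K (ae_of_all _ fun y => ?_)))
    rw [Real.norm_of_nonneg (sq_nonneg _)]
    exact hK x y
  rw [mixtureMeasure, stieltjesTransform_bind, integral_withDensity_eq_integral_toReal_smul
    ((hσ.measurable_right x).pow_const 2).ennreal_ofReal
    (ae_of_all _ fun y => ENNReal.ofReal_lt_top), kernelOp]
  refine integral_congr_ae (ae_of_all _ fun y => ?_)
  simp only
  rw [ENNReal.toReal_ofReal (sq_nonneg _), Complex.real_smul]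

/-- Splitting `σ² f - τ² g = σ² (f - g) + (σ² - τ²) g` serves both contraction (`σ = τ`, `η = 0`)
and stability. -/
lemma norm_kernelOp_sub_le {σ τ : unitInterval → unitInterval → ℝ} (hσ : IsBoundedMeasurable σ)
    (hτ : IsBoundedMeasurable τ) {K η B D : ℝ} (hK0 : 0 ≤ K) (hη : 0 ≤ η)
    (hK : ∀ x y, σ x y ^ 2 ≤ K) (hστ : ∀ x y, |σ x y ^ 2 - τ x y ^ 2| ≤ η)
    {f g : unitInterval → ℂ} (hf : Measurable f) (hg : Measurable g)
    (hfB : ∀ y, ‖f y‖ ≤ B) (hgB : ∀ y, ‖g y‖ ≤ B) (hfg : ∀ y, ‖f y - g y‖ ≤ D)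
    (x : unitInterval) :
    ‖kernelOp σ f x - kernelOp τ g x‖ ≤ K * D + η * B := by
  have hint : ∀ {ρ : unitInterval → unitInterval → ℝ} {h : unitInterval → ℂ},
      IsBoundedMeasurable ρ → Measurable h → (∀ y, ‖h y‖ ≤ B) →
      Integrable fun y => ((ρ x y ^ 2 : ℝ) : ℂ) * h y := by
    intro ρ h hρ hh hhB
    obtain ⟨L, hL0, hL⟩ := hρ.exists_sq_le
    refine Integrable.of_bound ((Complex.measurable_ofReal.comp
      ((hρ.measurable_right x).pow_const 2)).mul hh).aestronglyMeasurable (L * B)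
      (ae_of_all _ fun y => ?_)
    rw [norm_mul, Complex.norm_of_nonneg (sq_nonneg _)]
    exact mul_le_mul (hL x y) (hhB y) (norm_nonneg _) hL0
  rw [kernelOp, kernelOp, ← integral_sub (hint hσ hf hfB) (hint hτ hg hgB)]
  have := norm_integral_le_of_norm_le_const (μ := (volume : Measure unitInterval))
    (f := fun y => ((σ x y ^ 2 : ℝ) : ℂ) * f y - ((τ x y ^ 2 : ℝ) : ℂ) * g y)
    (C := K * D + η * B) (ae_of_all _ fun y => ?_)
  · simpa using this
  · have h1 : ((σ x y ^ 2 : ℝ) : ℂ) * f y - ((τ x y ^ 2 : ℝ) : ℂ) * g y =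
        ((σ x y ^ 2 : ℝ) : ℂ) * (f y - g y) + ((σ x y ^ 2 - τ x y ^ 2 : ℝ) : ℂ) * g y := by
      push_cast
      ring
    rw [h1]
    refine (norm_add_le _ _).trans (add_le_add ?_ ?_)
    · rw [norm_mul, Complex.norm_of_nonneg (sq_nonneg _)]
      exact mul_le_mul (hK x y) (hfg y) (norm_nonneg _) hK0
    · rw [norm_mul, Complex.norm_real]
      exact mul_le_mul (hστ x y) (hgB y) (norm_nonneg _) hη

/-! ### The fixed point iteration -/

/-- `p'` arises from `p` by one step of the fixed point iteration for the canonical equation. -/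
def IsCanonicalStep (σ : unitInterval → unitInterval → ℝ) (p p' : Kernel unitInterval ℝ) : Prop :=
  ∀ z x, stieltjesTransform (p' x) z =
    -1 / (z + kernelOp σ (fun y => stieltjesTransform (p y) z) x)

lemma add_kernelOp_ne_zero {σ : unitInterval → unitInterval → ℝ} (hσ : IsBoundedMeasurable σ)
    (p : Kernel unitInterval ℝ) [IsMarkovKernel p] (z : ℍ) (x : unitInterval) :
    (z : ℂ) + kernelOp σ (fun y => stieltjesTransform (p y) z) x ≠ 0 := by
  obtain ⟨K, -, hK⟩ := hσ.exists_sq_le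
  have := isFiniteMeasure_mixtureMeasure hK p x
  rw [← stieltjesTransform_mixtureMeasure hσ]
  exact add_stieltjesTransform_ne_zero _ z

/-- The measures are chosen separately for each `x`; they form a kernel because their Stieltjes
transforms are measurable in `x`. -/
lemma exists_isCanonicalStep {σ : unitInterval → unitInterval → ℝ} (hσ : IsBoundedMeasurable σ)
    (p : Kernel unitInterval ℝ) [IsMarkovKernel p] :
    ∃ p' : Kernel unitInterval ℝ, IsMarkovKernel p' ∧ IsCanonicalStep σ p p' := by
  obtain ⟨K, -, hK⟩ := hσ.exists_sq_le
  have hfin := isFiniteMeasure_mixtureMeasure hK p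
  choose ρ hρ using fun x => exists_stieltjesTransform_eq (mixtureMeasure σ p x)
  simp only [stieltjesTransform_mixtureMeasure hσ] at hρ
  refine ⟨⟨fun x => (ρ x : Measure ℝ), measurable_of_measurable_stieltjesTransform _ fun z => ?_⟩,
    ⟨fun x => (ρ x).2⟩, fun z x => hρ x z⟩
  simp only [hρ]
  exact ((measurable_kernelOp hσ (measurable_stieltjesTransform p z)).const_add _).const_div _

lemma IsCanonicalStep.norm_one_add_mul_le {σ : unitInterval → unitInterval → ℝ}
    (hσ : IsBoundedMeasurable σ) {K : ℝ} (hK0 : 0 ≤ K) (hK : ∀ x y, σ x y ^ 2 ≤ K)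
    {p p' : Kernel unitInterval ℝ} [IsMarkovKernel p] [IsMarkovKernel p']
    (h : IsCanonicalStep σ p p') (z : ℍ) (x : unitInterval) :
    ‖1 + z * stieltjesTransform (p' x) z‖ ≤ K / z.im ^ 2 := by
  have := isFiniteMeasure_mixtureMeasure hK p x
  have h1 := h z x
  rw [← stieltjesTransform_mixtureMeasure hσ] at h1
  refine (_root_.norm_one_add_mul_le h1).trans ?_
  gcongr
  exact ENNReal.toReal_le_of_le_ofReal hK0 (mixtureMeasure_univ_le hK p x)

/-- The difference of the new transforms is their product times the difference of the `S`-terms. The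
product is at most `1 / (Im z)²`, so the Lipschitz constant is `K / (Im z)² ≤ 1/2`. -/
lemma IsCanonicalStep.norm_sub_le {σ τ : unitInterval → unitInterval → ℝ}
    (hσ : IsBoundedMeasurable σ) (hτ : IsBoundedMeasurable τ) {K η D : ℝ} (hK0 : 0 ≤ K)
    (hη : 0 ≤ η) (hK : ∀ x y, σ x y ^ 2 ≤ K) (hστ : ∀ x y, |σ x y ^ 2 - τ x y ^ 2| ≤ η)
    {p p' r r' : Kernel unitInterval ℝ} [IsMarkovKernel p] [IsMarkovKernel p'] [IsMarkovKernel r]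
    [IsMarkovKernel r'] (hp : IsCanonicalStep σ p p') (hr : IsCanonicalStep τ r r')
    {z : ℍ} (hz : 2 * K ≤ z.im ^ 2)
    (hD : ∀ y, ‖stieltjesTransform (p y) z - stieltjesTransform (r y) z‖ ≤ D)
    (x : unitInterval) :
    ‖stieltjesTransform (p' x) z - stieltjesTransform (r' x) z‖ ≤ D / 2 + η / z.im ^ 3 := by
  have hy := z.im_pos
  have hD0 : 0 ≤ D := (norm_nonneg _).trans (hD x)
  have hS := norm_kernelOp_sub_le hσ hτ hK0 hη hK hστ (measurable_stieltjesTransform p z)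
    (measurable_stieltjesTransform r z) (fun y => norm_stieltjesTransform_le_one_div (p y) z)
    (fun y => norm_stieltjesTransform_le_one_div (r y) z) hD x
  have h1 := add_kernelOp_ne_zero hσ p z x
  have h2 := add_kernelOp_ne_zero hτ r z x
  have heq : stieltjesTransform (p' x) z - stieltjesTransform (r' x) z =
      stieltjesTransform (p' x) z * stieltjesTransform (r' x) z *
        (kernelOp σ (fun y => stieltjesTransform (p y) z) x -
          kernelOp τ (fun y => stieltjesTransform (r y) z) x) := by
    rw [hp z x, hr z x]
    field_simp
    ring
  rw [heq, norm_mul, norm_mul]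
  calc _ ≤ 1 / z.im * (1 / z.im) * (K * D + η * (1 / z.im)) := by
        gcongr
        · exact norm_stieltjesTransform_le_one_div _ z
        · exact norm_stieltjesTransform_le_one_div _ z
    _ = K / z.im ^ 2 * D + η / z.im ^ 3 := by
        field_simp
    _ ≤ 1 / 2 * D + η / z.im ^ 3 := by
        gcongr ?_ * D + _
        rw [div_le_div_iff₀ (by positivity) two_pos]
        linarith
    _ = _ := by ring

lemma norm_stieltjesTransform_sub_le (μ ν : Measure ℝ) [IsProbabilityMeasure μ]
    [IsProbabilityMeasure ν] (z : ℍ) :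
    ‖stieltjesTransform μ z - stieltjesTransform ν z‖ ≤ 2 / z.im := by
  refine (norm_sub_le _ _).trans ((add_le_add (norm_stieltjesTransform_le_one_div μ z)
    (norm_stieltjesTransform_le_one_div ν z)).trans_eq (by ring))

/-- The canonical equation is solved by the Stieltjes transforms of a Markov kernel. -/
theorem exists_isCanonicalStep_self {σ : unitInterval → unitInterval → ℝ}
    (hσ : IsBoundedMeasurable σ) :
    ∃ p : Kernel unitInterval ℝ, IsMarkovKernel p ∧ IsCanonicalStep σ p p := by
  obtain ⟨K, hK0, hK⟩ := hσ.exists_sq_le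
  obtain ⟨P, hP⟩ : ∃ P : ℕ → {p : Kernel unitInterval ℝ // IsMarkovKernel p},
      ∀ n, IsCanonicalStep σ (P n).1 (P (n + 1)).1 := by
    choose F hF using fun p : {p : Kernel unitInterval ℝ // IsMarkovKernel p} =>
      have := p.2
      exists_isCanonicalStep hσ p.1
    exact ⟨fun n => Nat.rec ⟨Kernel.const _ (Measure.dirac 0), inferInstance⟩
      (fun _ p => ⟨F p, (hF p).1⟩) n, fun n => (hF _).2⟩
  have hPm := fun n => (P n).2
  have hdist : ∀ z : ℍ, 2 * K ≤ z.im ^ 2 → ∀ n x,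
      dist (stieltjesTransform ((P n).1 x) z) (stieltjesTransform ((P (n + 1)).1 x) z) ≤
        2 / z.im * (1 / 2) ^ n := by
    intro z hz n
    induction n with
    | zero =>
      intro x
      rw [dist_eq_norm, pow_zero, mul_one]
      exact norm_stieltjesTransform_sub_le _ _ z
    | succ n ih =>
      intro x
      have := (hP n).norm_sub_le hσ hσ hK0 le_rfl hK (fun x y => by simp) (hP (n + 1)) hz
        (fun y => (dist_eq_norm _ _).symm.trans_le (ih y)) x
      rw [dist_eq_norm]
      exact this.trans_eq (by ring)
  -- The index starts at `n + 1` because the tail bound is for outputs of a step. Convergence is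
  -- known only high up, but the weak limit yields it at every `z`.
  have hlim : ∀ x, ∃ ν : ProbabilityMeasure ℝ, ∀ z, Tendsto
      (fun n => stieltjesTransform ((P (n + 1)).1 x) z) atTop
      (𝓝 (stieltjesTransform (ν : Measure ℝ) z)) := by
    intro x
    have hcau : ∀ z : ℍ, √(2 * K) < z.im → ∃ w, Tendsto
        (fun n => stieltjesTransform ((P (n + 1)).1 x) z) atTop (𝓝 w) := by
      intro z hz
      obtain ⟨w, hw⟩ := cauchySeq_tendsto_of_complete (cauchySeq_of_le_geometric _ _ (by norm_num)
        fun n => hdist z (Real.lt_sq_of_sqrt_lt hz).le n x)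
      exact ⟨w, hw.comp (tendsto_add_atTop_nat 1)⟩
    -- Only the values above height `√(2K)`, where the limit exists, are used.
    let g : ℍ → ℂ := fun z => limUnder atTop fun n => stieltjesTransform ((P (n + 1)).1 x) z
    obtain ⟨ν, hν⟩ := exists_tendsto_of_tendsto_stieltjesTransform
      (μ := fun n => ⟨(P (n + 1)).1 x, inferInstance⟩) (C := K) (Y := √(2 * K)) (g := g)
      (fun n y hy => (hP n).norm_one_add_mul_le hσ hK0 hK (imaginaryPoint y hy) x)
      (fun z hz => tendsto_nhds_limUnder (hcau z hz))
    exact ⟨ν, fun z => ((continuous_stieltjesTransform z).tendsto ν).comp hν⟩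
  choose ν hν using hlim
  let p : Kernel unitInterval ℝ := ⟨fun x => (ν x : Measure ℝ),
    measurable_of_measurable_stieltjesTransform _ fun z =>
      measurable_of_tendsto_metrizable
        (fun n => measurable_stieltjesTransform (P (n + 1)).1 z)
        (tendsto_pi_nhds.2 fun x => hν x z)⟩
  have hp : IsMarkovKernel p := ⟨fun x => (ν x).2⟩
  refine ⟨p, hp, fun z x => ?_⟩
  refine tendsto_nhds_unique ((tendsto_add_atTop_iff_nat 1).2 (hν x z)) ?_
  simp only [hP (_ + 1) z x]
  refine Tendsto.div tendsto_const_nhds (Tendsto.const_add _ ?_) (add_kernelOp_ne_zero hσ p z x)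
  refine tendsto_integral_of_dominated_convergence (fun _ => K * (1 / z.im)) (fun n => ?_)
    (integrable_const _) (fun n => ae_of_all _ fun y => ?_) (ae_of_all _ fun y => ?_)
  · exact ((Complex.measurable_ofReal.comp ((hσ.measurable_right x).pow_const 2)).mul
      (measurable_stieltjesTransform _ z)).aestronglyMeasurable
  · rw [norm_mul, Complex.norm_of_nonneg (sq_nonneg _)]
    exact mul_le_mul (hK x y) (norm_stieltjesTransform_le_one_div _ z) (norm_nonneg _) hK0
  · exact (hν y z).const_mul _

/-! ### Uniqueness and stability of the limit measure -/

lemma IsCanonicalStep.isLimitMeasure {σ : unitInterval → unitInterval → ℝ}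
    (hσ : IsBoundedMeasurable σ) {p : Kernel unitInterval ℝ} [IsMarkovKernel p]
    (hp : IsCanonicalStep σ p p) : IsLimitMeasure σ ⟨Measure.bind volume p, inferInstance⟩ := by
  refine ⟨fun z x => ⟨stieltjesTransform (p x) z, im_stieltjesTransform_pos (p x) z⟩,
    ⟨fun z => measurable_stieltjesTransform p z,
      fun z => ⟨1 / z.im, fun x => norm_stieltjesTransform_le_one_div (p x) z⟩, fun z x => ?_⟩,
    p, inferInstance, fun z x => rfl, rfl⟩
  have := add_kernelOp_ne_zero hσ p z x
  change -1 / stieltjesTransform (p x) z = _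
  rw [hp z x]
  field_simp

lemma IsLimitMeasure.exists_isCanonicalStep {σ : unitInterval → unitInterval → ℝ}
    {μ : ProbabilityMeasure ℝ} (h : IsLimitMeasure σ μ) :
    ∃ p : Kernel unitInterval ℝ, IsMarkovKernel p ∧ IsCanonicalStep σ p p ∧
      (μ : Measure ℝ) = Measure.bind volume p := by
  obtain ⟨m, hm, p, hp, hmp, hμ⟩ := h
  refine ⟨p, hp, fun z x => ?_, hμ⟩
  have h1 := hm.equation z x
  simp only [hmp] at h1
  rw [← h1, div_div_eq_mul_div, neg_mul, one_mul, neg_div_neg_eq, div_one]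

theorem exists_isLimitMeasure {σ : unitInterval → unitInterval → ℝ} (hσ : IsBoundedMeasurable σ) :
    ∃ μ, IsLimitMeasure σ μ := by
  obtain ⟨p, hp, h⟩ := exists_isCanonicalStep_self hσ
  exact ⟨_, h.isLimitMeasure hσ⟩

/-- Starting from the trivial bound `2 / Im z`, iterating `D ↦ D / 2 + η / (Im z)³` converges to its
fixed point `2η / (Im z)³`. -/
lemma IsCanonicalStep.norm_sub_le_of_self {σ τ : unitInterval → unitInterval → ℝ}
    (hσ : IsBoundedMeasurable σ) (hτ : IsBoundedMeasurable τ) {K η : ℝ} (hK0 : 0 ≤ K)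
    (hη : 0 ≤ η) (hK : ∀ x y, σ x y ^ 2 ≤ K) (hστ : ∀ x y, |σ x y ^ 2 - τ x y ^ 2| ≤ η)
    {p r : Kernel unitInterval ℝ} [IsMarkovKernel p] [IsMarkovKernel r]
    (hp : IsCanonicalStep σ p p) (hr : IsCanonicalStep τ r r) {z : ℍ} (hz : 2 * K ≤ z.im ^ 2)
    (x : unitInterval) :
    ‖stieltjesTransform (p x) z - stieltjesTransform (r x) z‖ ≤ 2 * η / z.im ^ 3 := by
  have hy := z.im_pos
  have hn : ∀ (n : ℕ) x, ‖stieltjesTransform (p x) z - stieltjesTransform (r x) z‖ ≤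
      2 * η / z.im ^ 3 + 2 / z.im * (1 / 2) ^ n := by
    intro n
    induction n with
    | zero =>
      intro x
      rw [pow_zero, mul_one]
      exact (norm_stieltjesTransform_sub_le _ _ z).trans (le_add_of_nonneg_left (by positivity))
    | succ n ih =>
      intro x
      exact (hp.norm_sub_le hσ hτ hK0 hη hK hστ hr hz ih x).trans_eq (by ring)
  have hlim : Tendsto (fun n : ℕ => 2 * η / z.im ^ 3 + 2 / z.im * (1 / 2) ^ n) atTop
      (𝓝 (2 * η / z.im ^ 3 + 2 / z.im * 0)) :=
    ((tendsto_pow_atTop_nhds_zero_of_lt_one (by norm_num) (by norm_num)).const_mul _).const_add _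
  rw [mul_zero, add_zero] at hlim
  exact ge_of_tendsto' hlim fun n => hn n x

lemma integrable_stieltjesTransform (p : Kernel unitInterval ℝ) [IsMarkovKernel p] (z : ℍ) :
    Integrable fun x => stieltjesTransform (p x) z :=
  Integrable.of_bound (measurable_stieltjesTransform p z).aestronglyMeasurable (1 / z.im)
    (ae_of_all _ fun x => norm_stieltjesTransform_le_one_div (p x) z)

theorem IsLimitMeasure.norm_stieltjesTransform_sub_le {σ τ : unitInterval → unitInterval → ℝ}
    (hσ : IsBoundedMeasurable σ) (hτ : IsBoundedMeasurable τ) {K η : ℝ} (hK0 : 0 ≤ K)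
    (hη : 0 ≤ η) (hK : ∀ x y, σ x y ^ 2 ≤ K) (hστ : ∀ x y, |σ x y ^ 2 - τ x y ^ 2| ≤ η)
    {μ ν : ProbabilityMeasure ℝ} (hμ : IsLimitMeasure σ μ) (hν : IsLimitMeasure τ ν)
    {z : ℍ} (hz : 2 * K ≤ z.im ^ 2) :
    ‖stieltjesTransform (μ : Measure ℝ) z - stieltjesTransform (ν : Measure ℝ) z‖ ≤
      2 * η / z.im ^ 3 := by
  obtain ⟨p, hpm, hp, hμp⟩ := hμ.exists_isCanonicalStep
  obtain ⟨r, hrm, hr, hνr⟩ := hν.exists_isCanonicalStep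
  rw [hμp, hνr, stieltjesTransform_bind, stieltjesTransform_bind,
    ← integral_sub (integrable_stieltjesTransform p z) (integrable_stieltjesTransform r z)]
  have := norm_integral_le_of_norm_le_const (μ := (volume : Measure unitInterval))
    (ae_of_all _ fun x => hp.norm_sub_le_of_self hσ hτ hK0 hη hK hστ hr hz x)
  simpa using this

/-- Stability with `τ = σ` and `η = 0` gives equality high up, hence everywhere by continuation. -/
theorem IsLimitMeasure.unique {σ : unitInterval → unitInterval → ℝ} (hσ : IsBoundedMeasurable σ)
    {μ ν : ProbabilityMeasure ℝ} (hμ : IsLimitMeasure σ μ) (hν : IsLimitMeasure σ ν) : μ = ν := by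
  obtain ⟨K, hK0, hK⟩ := hσ.exists_sq_le
  have h : (μ : Measure ℝ) = ν := eq_of_stieltjesTransform_eq
    (stieltjesTransform_eq_of_eq_of_lt_im (Y := √(2 * K)) fun z hz => by
      have := hμ.norm_stieltjesTransform_sub_le hσ hσ hK0 le_rfl hK (fun x y => by simp) hν
        (Real.lt_sq_of_sqrt_lt hz).le
      rw [mul_zero, zero_div, norm_le_zero_iff, sub_eq_zero] at this
      exact this)
  exact Subtype.ext h

lemma IsLimitMeasure.norm_one_add_mul_le {σ : unitInterval → unitInterval → ℝ}
    (hσ : IsBoundedMeasurable σ) {K : ℝ} (hK0 : 0 ≤ K) (hK : ∀ x y, σ x y ^ 2 ≤ K)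
    {μ : ProbabilityMeasure ℝ} (hμ : IsLimitMeasure σ μ) (z : ℍ) :
    ‖1 + z * stieltjesTransform (μ : Measure ℝ) z‖ ≤ K / z.im ^ 2 := by
  obtain ⟨p, hpm, hp, hμp⟩ := hμ.exists_isCanonicalStep
  have h := norm_integral_le_of_norm_le_const (μ := (volume : Measure unitInterval))
    (ae_of_all _ fun x => hp.norm_one_add_mul_le hσ hK0 hK z x)
  rw [integral_add (integrable_const _) ((integrable_stieltjesTransform p z).const_mul _),
    integral_const_mul, ← stieltjesTransform_bind, ← hμp] at h
  simpa using h

theorem limitMeasure_spec {σ : unitInterval → unitInterval → ℝ} (hσ : IsBoundedMeasurable σ) :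
    IsLimitMeasure σ (limitMeasure σ) :=
  Classical.epsilon_spec (exists_isLimitMeasure hσ)

/-- The limit measure depends continuously on the square of the profile. -/
theorem tendsto_limitMeasure {σ : unitInterval → unitInterval → ℝ} (hσ : IsBoundedMeasurable σ)
    {τ : ℕ → unitInterval → unitInterval → ℝ} (hτ : ∀ n, IsBoundedMeasurable (τ n))
    (hστ : ∀ n x y, |σ x y ^ 2 - τ n x y ^ 2| ≤ 1 / ((n : ℝ) + 1)) :
    Tendsto (fun n => limitMeasure (τ n)) atTop (𝓝 (limitMeasure σ)) := by
  obtain ⟨K, hK0, hK⟩ := hσ.exists_sq_le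
  -- A bound uniform in `n`, for tightness; the stability estimate needs only the bound on `σ²`.
  have hK' : ∀ n x y, τ n x y ^ 2 ≤ K + 1 := fun n x y => by
    have h1 := neg_le_of_abs_le (hστ n x y)
    have h2 : 1 / ((n : ℝ) + 1) ≤ 1 := Nat.one_div_le_one_div (Nat.zero_le n) |>.trans_eq (by simp)
    linarith [hK x y]
  have hlim : ∀ z : ℍ, √(2 * K) < z.im → Tendsto
      (fun n => stieltjesTransform (limitMeasure (τ n) : Measure ℝ) z) atTop
      (𝓝 (stieltjesTransform (limitMeasure σ : Measure ℝ) z)) := by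
    intro z hz
    have h0 : Tendsto (fun n : ℕ => 2 * (1 / ((n : ℝ) + 1)) / z.im ^ 3) atTop
        (𝓝 (2 * 0 / z.im ^ 3)) :=
      (tendsto_one_div_add_atTop_nhds_zero_nat.const_mul 2).div_const _
    rw [mul_zero, zero_div] at h0
    refine tendsto_iff_norm_sub_tendsto_zero.2 (squeeze_zero (fun _ => norm_nonneg _)
      (fun n => ?_) h0)
    rw [norm_sub_rev]
    exact (limitMeasure_spec hσ).norm_stieltjesTransform_sub_le hσ (hτ n) hK0 (by positivity) hK
      (hστ n) (limitMeasure_spec (hτ n)) (Real.lt_sq_of_sqrt_lt hz).le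
  obtain ⟨ν, hν⟩ := exists_tendsto_of_tendsto_stieltjesTransform (C := K + 1)
    (fun n y hy => (limitMeasure_spec (hτ n)).norm_one_add_mul_le (hτ n) (by linarith) (hK' n)
      (imaginaryPoint y hy)) hlim
  have h : (ν : Measure ℝ) = limitMeasure σ := eq_of_stieltjesTransform_eq
    (stieltjesTransform_eq_of_eq_of_lt_im (Y := √(2 * K)) fun z hz =>
      tendsto_nhds_unique (((continuous_stieltjesTransform z).tendsto ν).comp hν) (hlim z hz))
  rwa [show ν = limitMeasure σ from Subtype.ext h] at hν

theorem mainTheorem12 (σ : unitInterval → unitInterval → ℝ) (hσ : IsBoundedMeasurable σ) :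
    (∃! μ : ProbabilityMeasure ℝ, IsLimitMeasure σ μ) ∧
    ∀ V : Set (ProbabilityMeasure ℝ), IsOpen V → limitMeasure σ ∈ V →
      ∃ η : ℝ, 0 < η ∧ ∀ τ : unitInterval → unitInterval → ℝ, IsBoundedMeasurable τ →
        (∀ x y, |σ x y ^ 2 - τ x y ^ 2| ≤ η) → limitMeasure τ ∈ V := by
  refine ⟨⟨limitMeasure σ, limitMeasure_spec hσ, fun ν hν => hν.unique hσ (limitMeasure_spec hσ)⟩,
    fun V hV hσV => ?_⟩
  -- If every `η = 1 / (n + 1)` fails, the counterexamples form a sequence whose measures avoid `V`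
  -- yet converge to `limitMeasure σ`.
  by_contra! h
  choose τ hτ hστ hτV using fun n : ℕ => h (1 / ((n : ℝ) + 1)) (by positivity)
  obtain ⟨n, hn⟩ := ((tendsto_limitMeasure hσ hτ hστ).eventually (hV.mem_nhds hσV)).exists
  exact hτV n hn
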